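/- For a positive integer $N$ let $M_0^\sharp(N)$ be the space of functions on the complex upper half-plane that are holomorphic there, invariant under $\Gamma_0(N)$, meromorphic at the cusp $\infty$, and holomorphic at every cusp of $\Gamma_0(N)$ not equivalent to $\infty$. Write $q=e^{2\pi i z}$, and for $f=\sum_{n\ge n_0}a(n)q^n$ put $U_2(f)=\sum_{n}a(2n)q^n$. For $N\in\{2,4\}$ and every integer $m\ge 0$ there is exactly one function $f_{0,m}^{(N)}\in M_0^\sharp(N)$ whose Fourier expansion has the form $q^{-m}+\sum_{n\ge1}a(n)q^n$. For every integer $m\ge0$, $$U_2\bigl(f_{0,2m}^{(4)}\bigr)=f_{0,m}^{(2)}\qquad\text{and}\qquad U_2\bigl(f_{0,2m+1}^{(4)}\bigr)=0 .$$ -/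

import Mathlib

open UpperHalfPlane Matrix.SpecialLinearGroup CongruenceSubgroup
open scoped MatrixGroups ModularForm Manifold OnePoint

noncomputable section

namespace WeaklyHolomorphic

/-- The nome `q = exp (2 π i z)`. -/
abbrev q (z : ℍ) : ℂ := Function.Periodic.qParam 1 (z : ℂ)

/-- `f` has the Fourier expansion `f(z) = ∑_{n ≥ n₀} a(n) qⁿ`, with only finitely many nonzero
coefficients of negative index, (absolutely) convergent on the whole upper half-plane. -/
structure HasFourierExpansion (f : ℍ → ℂ) (a : ℤ → ℂ) : Prop where
  eventually_zero : ∃ n₀ : ℤ, ∀ n < n₀, a n = 0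
  hasSum : ∀ z : ℍ, HasSum (fun n : ℤ => a n * q z ^ n) (f z)

/-- The space `M_k^♯(N)`: functions on the upper half-plane that are holomorphic, invariant of
weight `k` under `Γ₀(N)`, meromorphic at the cusp `∞`, and holomorphic at every cusp that is not
`Γ₀(N)`-equivalent to `∞`. -/
structure IsMSharp (k : ℤ) (N : ℕ) (f : ℍ → ℂ) : Prop where
  holo : MDiff f
  slash_eq : ∀ γ ∈ Gamma0 N, f ∣[k] γ = f
  meromorphic_infty : ∃ a : ℤ → ℂ, HasFourierExpansion f a
  bdd_at_other_cusps : ∀ c : OnePoint ℝ, IsCusp c ((Gamma0 N).map (mapGL ℝ)) →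
    (∀ γ ∈ Gamma0 N, mapGL ℝ γ • (∞ : OnePoint ℝ) ≠ c) → c.IsBoundedAt f k

/-- The property defining the canonical basis element `f_{0,m}^{(N)}`: it lies in `M_0^♯(N)` and
its Fourier expansion is `q^{-m} + ∑_{n ≥ 1} a(n) qⁿ`. -/
def IsCanonical (N m : ℕ) (f : ℍ → ℂ) : Prop :=
  IsMSharp 0 N f ∧ ∃ a : ℤ → ℂ, HasFourierExpansion f a ∧
    a (-(m : ℤ)) = 1 ∧ ∀ n : ℤ, n ≤ 0 → n ≠ -(m : ℤ) → a n = 0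

/-- The `n`-th Fourier coefficient `∫₀¹ f(x + i) exp (-2 π i n (x + i)) dx`. -/
def qCoeff (f : ℍ → ℂ) (n : ℤ) : ℂ :=
  ∫ x in (0 : ℝ)..1, f (x +ᵥ UpperHalfPlane.I) * q (x +ᵥ UpperHalfPlane.I) ^ (-n)

/-- The operator `U_p : ∑ a(n) qⁿ ↦ ∑ a(pn) qⁿ`. -/
def U (p : ℕ) (f : ℍ → ℂ) : ℍ → ℂ :=
  fun z => ∑' n : ℤ, qCoeff f (p * n) * q z ^ n

end WeaklyHolomorphic

end

noncomputable section

namespace WeaklyHolomorphic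

open Filter Topology Function

/-! Uniqueness: a function in M_0^♯(N) without nonpositive Fourier coefficients is a weight 0
modular form vanishing at ∞, hence zero (`eq_zero_of_mem_expansions`). Existence: (η(z)/η(2z))^24
and (η(z)/η(4z))^8 have a simple pole in q at ∞ and are bounded at the other cusps; their powers
supply every leading term q^{-m}, and triangular elimination (`exists_isCanonical`) clears the other
nonpositive coefficients. The operator: U_2 f is the sum of the weight 0 slashes of f by z ↦ z/2 and
z ↦ (z+1)/2. For f of level 4, Γ₀(2) permutes these two terms and the sum stays bounded away from ∞,
so U_2 maps M_0^♯(4) into M_0^♯(2) (`IsMSharp.U_two`). The nonpositive coefficients of the image are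
those of f at even indices: q^{-2m} becomes q^{-m}, while an odd leading exponent leaves nothing;
uniqueness at level 2 finishes. -/

/-! ### Fourier expansions and their coefficients -/

lemma q_ne_zero (z : ℍ) : q z ≠ 0 := Periodic.qParam_ne_zero _

lemma q_one_vadd (z : ℍ) : q ((1 : ℝ) +ᵥ z) = q z := by
  simp only [q, Periodic.qParam, coe_vadd]
  rw [Complex.exp_eq_exp_iff_exists_int]
  exact ⟨1, by push_cast; ring⟩

/-- A holomorphic `1`-periodic function with a pole of order at most `m` at `i∞` has a Fourier
expansion starting at `q ^ (-m)`. -/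
lemma exists_hasFourierExpansion {f : ℍ → ℂ} (hf : MDiff f) (hper : ∀ z, f ((1 : ℝ) +ᵥ z) = f z)
    {m : ℕ} {c : ℂ} (hlim : Tendsto (fun z ↦ q z ^ m * f z) atImInfty (𝓝 c)) :
    ∃ a : ℤ → ℂ, HasFourierExpansion f a ∧ a (-m) = c ∧ ∀ n < -(m : ℤ), a n = 0 := by
  set g : ℍ → ℂ := fun z ↦ q z ^ m * f z with hg
  have hq : MDiff q := fun z ↦
    (Periodic.differentiable_qParam (h := 1)).mdifferentiable.comp mdifferentiable_coe z
  have hgd : MDiff g := (hq.pow m).mul hf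
  have hgper : Periodic (g ∘ ofComplex) (1 : ℝ) := by
    intro w
    by_cases hw : 0 < w.im
    · have h1 : 0 < (w + (1 : ℝ)).im := by simpa using hw
      have h2 : (⟨w + (1 : ℝ), h1⟩ : ℍ) = (1 : ℝ) +ᵥ (⟨w, hw⟩ : ℍ) := by
        ext; simp [add_comm]
      simp only [comp_apply, ofComplex_apply_of_im_pos h1, ofComplex_apply_of_im_pos hw, h2, hg,
        q_one_vadd, hper]
    · have h1 : (w + (1 : ℝ)).im ≤ 0 := by simpa using hw
      simp only [comp_apply, ofComplex_apply_of_im_nonpos h1,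
        ofComplex_apply_of_im_nonpos (not_lt.mp hw)]
  have hgb : IsBoundedAtImInfty g := hlim.isBigO_one ℝ
  have hsum := hasSum_qExpansion one_pos hgper hgd hgb
  have h0 : (qExpansion 1 g).coeff 0 = c := by
    rw [qExpansion_coeff_zero one_pos (analyticAt_cuspFunction_zero one_pos hgper hgd hgb) hgper]
    exact hlim.limUnder_eq
  refine ⟨fun n ↦ if n < -(m : ℤ) then 0 else (qExpansion 1 g).coeff (n + m).toNat,
    ⟨⟨-m, fun n hn ↦ if_pos hn⟩, fun z ↦ ?_⟩, by simp [h0], fun n hn ↦ if_pos hn⟩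
  have hinj : Injective (fun n : ℕ ↦ (n : ℤ) - m) := fun a b h ↦ by simpa using h
  rw [← hinj.hasSum_iff]
  · convert! (hsum z).mul_left (q z ^ (-(m : ℤ))) using 1
    · ext n
      simp only [comp_apply, sub_add_cancel, Int.toNat_natCast, smul_eq_mul]
      rw [if_neg (by omega), sub_eq_add_neg, zpow_add₀ (q_ne_zero z), zpow_natCast]
      ring
    · simp only [hg]
      rw [zpow_neg, zpow_natCast, inv_mul_cancel_left₀ (pow_ne_zero _ (q_ne_zero z))]
  · intro n hn
    have : n < -(m : ℤ) := by
      by_contra h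
      exact hn ⟨(n + m).toNat, by simp only; omega⟩
    simp [this]

lemma HasFourierExpansion.isBoundedAtImInfty {f : ℍ → ℂ} {a : ℤ → ℂ}
    (hf : HasFourierExpansion f a) (ha : ∀ n < 0, a n = 0) : IsBoundedAtImInfty f := by
  refine isBoundedAtImInfty_of_hasSum_qExpansion (c := fun n : ℕ ↦ a n) one_pos fun z ↦ ?_
  have hinj : Injective (fun n : ℕ ↦ (n : ℤ)) := Nat.cast_injective
  have := hf.hasSum z
  rw [← hinj.hasSum_iff] at this
  · simpa [comp_def] using this
  · intro n hn
    rw [ha n, zero_mul]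
    by_contra h
    exact hn ⟨n.toNat, by simp only; omega⟩

lemma HasFourierExpansion.isZeroAtImInfty {f : ℍ → ℂ} {a : ℤ → ℂ}
    (hf : HasFourierExpansion f a) (ha : ∀ n ≤ 0, a n = 0) : IsZeroAtImInfty f := by
  have key : HasFourierExpansion (fun z ↦ (q z)⁻¹ * f z) (fun n ↦ a (n + 1)) := by
    refine ⟨⟨0, fun n hn ↦ ha _ (by omega)⟩, fun z ↦ ?_⟩
    have := (hf.hasSum z).mul_left (q z)⁻¹
    rw [← (Equiv.addRight (1 : ℤ)).hasSum_iff] at this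
    convert! this using 2 with n
    simp only [comp_apply, Equiv.coe_addRight, zpow_add_one₀ (q_ne_zero z)]
    field_simp [q_ne_zero z]
  have hb := key.isBoundedAtImInfty fun n hn ↦ ha _ (by omega)
  have h0 : IsZeroAtImInfty q := qParam_tendsto_atImInfty one_pos
  have := BoundedAtFilter.mul_zeroAtFilter hb h0
  refine this.congr fun z ↦ ?_
  simp only [Pi.mul_apply]
  field_simp [q_ne_zero z]

lemma integral_q_zpow (k : ℤ) :
    ∫ x in (0 : ℝ)..1, q (x +ᵥ UpperHalfPlane.I) ^ k = if k = 0 then 1 else 0 := by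
  have hq (x : ℝ) : q (x +ᵥ UpperHalfPlane.I) ^ k =
      q UpperHalfPlane.I ^ k * Complex.exp (2 * Real.pi * Complex.I * k * x) := by
    simp only [q, Periodic.qParam, ← Complex.exp_int_mul, ← Complex.exp_add]
    congr 1
    simp
    ring
  split_ifs with hk
  · simp [hk]
  simp only [hq, intervalIntegral.integral_const_mul]
  rw [integral_exp_mul_complex (by simp [hk, Real.pi_ne_zero])]
  have : Complex.exp (2 * Real.pi * Complex.I * k) = 1 := by
    rw [Complex.exp_eq_one_iff]
    exact ⟨k, by ring⟩
  simp [this]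

/-- Integrate term by term along Im z = 1: |q| is constant there, so the absolutely convergent
series is its own dominating bound. -/
lemma HasFourierExpansion.qCoeff_eq {f : ℍ → ℂ} {a : ℤ → ℂ}
    (hf : HasFourierExpansion f a) (n : ℤ) : qCoeff f n = a n := by
  have hnorm (x : ℝ) : ‖q (x +ᵥ UpperHalfPlane.I)‖ = ‖q UpperHalfPlane.I‖ := by
    simp [q, Periodic.norm_qParam]
  have hcont : Continuous fun x : ℝ ↦ q (x +ᵥ UpperHalfPlane.I) := by
    simp only [q, coe_vadd]
    exact (Periodic.continuous_qParam).comp (by fun_prop)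
  have hterm (k : ℤ) : Continuous fun x : ℝ ↦
      a k * q (x +ᵥ UpperHalfPlane.I) ^ k * q (x +ᵥ UpperHalfPlane.I) ^ (-n) :=
    (continuous_const.mul (hcont.zpow₀ _ fun _ ↦ .inl (q_ne_zero _))).mul
      (hcont.zpow₀ _ fun _ ↦ .inl (q_ne_zero _))
  have hs := intervalIntegral.hasSum_integral_of_dominated_convergence
    (μ := MeasureTheory.volume) (a := 0) (b := 1)
    (F := fun (k : ℤ) (x : ℝ) ↦
      a k * q (x +ᵥ UpperHalfPlane.I) ^ k * q (x +ᵥ UpperHalfPlane.I) ^ (-n))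
    (f := fun x : ℝ ↦ f (x +ᵥ UpperHalfPlane.I) * q (x +ᵥ UpperHalfPlane.I) ^ (-n))
    (fun k _ ↦ ‖a k * q UpperHalfPlane.I ^ k * q UpperHalfPlane.I ^ (-n)‖)
    (fun k ↦ (hterm k).aestronglyMeasurable)
    (fun k ↦ .of_forall fun x _ ↦ by simp only [norm_mul, norm_zpow, hnorm, le_refl])
    (.of_forall fun x _ ↦ ((hf.hasSum _).summable.mul_right _).norm)
    (by simp)
    (.of_forall fun x _ ↦ (hf.hasSum _).mul_right _)
  have hval (k : ℤ) : ∫ x in (0 : ℝ)..1,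
      a k * q (x +ᵥ UpperHalfPlane.I) ^ k * q (x +ᵥ UpperHalfPlane.I) ^ (-n) =
      if k = n then a n else 0 := by
    simp only [mul_assoc, ← zpow_add₀ (q_ne_zero _), intervalIntegral.integral_const_mul,
      integral_q_zpow, ← sub_eq_add_neg, sub_eq_zero]
    split_ifs with h <;> simp [h]
  simp only [hval] at hs
  exact hs.unique (hasSum_ite_eq n (a n))

/-! ### Cusp conditions, uniqueness and elimination -/

lemma slash_zero_apply (f : ℍ → ℂ) (γ : SL(2, ℤ)) (z : ℍ) : (f ∣[(0 : ℤ)] γ) z = f (γ • z) := by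
  simp [ModularForm.SL_slash_apply]

lemma mem_Gamma0_iff_dvd {N : ℕ} {γ : SL(2, ℤ)} : γ ∈ Gamma0 N ↔ (N : ℤ) ∣ γ 1 0 := by
  rw [Gamma0_mem, ZMod.intCast_zmod_eq_zero_iff_dvd]

/-- The stabilizer of ∞ is upper triangular, hence inside Γ₀(N). So the cusps other than ∞ are the
γ∞ with γ ∉ Γ₀(N), and the cusp condition can be tested on f ∣ γ. -/
lemma mem_Gamma0_of_smul_infty_eq {N : ℕ} {γ δ : SL(2, ℤ)} (hδ : δ ∈ Gamma0 N)
    (h : mapGL ℝ δ • (∞ : OnePoint ℝ) = mapGL ℝ γ • ∞) : γ ∈ Gamma0 N := by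
  have h1 : mapGL ℝ (δ⁻¹ * γ) • (∞ : OnePoint ℝ) = ∞ := by
    rw [map_mul, mul_smul, ← h, map_inv, inv_smul_smul]
  rw [OnePoint.smul_infty_eq_self_iff] at h1
  have h2 : (δ⁻¹ * γ) 1 0 = 0 := by
    generalize δ⁻¹ * γ = ε at h1
    simpa using h1
  have h3 : δ⁻¹ * γ ∈ Gamma0 N := by
    rw [Gamma0_mem, h2, Int.cast_zero]
  simpa using mul_mem hδ h3

lemma IsMSharp.isBoundedAtImInfty_slash {k : ℤ} {N : ℕ} [NeZero N] {f : ℍ → ℂ}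
    (hf : IsMSharp k N f) {γ : SL(2, ℤ)} (hγ : γ ∉ Gamma0 N) : IsBoundedAtImInfty (f ∣[k] γ) := by
  have hc : IsCusp (mapGL ℝ γ • (∞ : OnePoint ℝ)) 𝒮ℒ := isCusp_SL2Z_iff'.mpr ⟨γ, rfl⟩
  exact hf.bdd_at_other_cusps _
    ((Subgroup.IsArithmetic.isCusp_iff_isCusp_SL2Z _).mpr hc)
    (fun δ hδ h ↦ hγ (mem_Gamma0_of_smul_infty_eq hδ h)) _ rfl

lemma IsMSharp.of_slash {k : ℤ} {N : ℕ} [NeZero N] {f : ℍ → ℂ} (holo : MDiff f)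
    (slash_eq : ∀ γ ∈ Gamma0 N, f ∣[k] γ = f) {a : ℤ → ℂ} (hfa : HasFourierExpansion f a)
    (hbdd : ∀ γ ∉ Gamma0 N, IsBoundedAtImInfty (f ∣[k] γ)) : IsMSharp k N f where
  holo := holo
  slash_eq := slash_eq
  meromorphic_infty := ⟨a, hfa⟩
  bdd_at_other_cusps c hc hne := by
    rw [Subgroup.IsArithmetic.isCusp_iff_isCusp_SL2Z] at hc
    rw [OnePoint.isBoundedAt_iff_forall_SL2Z hc]
    exact fun γ hγ ↦ hbdd γ fun h ↦ hne γ h hγ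

/-- The pairs of a function in `M_0^♯(N)` and its sequence of Fourier coefficients. -/
def expansions (N : ℕ) [NeZero N] : Submodule ℂ ((ℍ → ℂ) × (ℤ → ℂ)) where
  carrier := {p | IsMSharp 0 N p.1 ∧ HasFourierExpansion p.1 p.2}
  zero_mem' := by
    have h0 : HasFourierExpansion 0 0 := ⟨⟨0, fun _ _ ↦ rfl⟩, fun z ↦ by simp⟩
    exact ⟨.of_slash mdifferentiable_const (fun γ _ ↦ SlashAction.zero_slash _ _) h0 fun γ _ ↦ by
      rw [Prod.fst_zero, SlashAction.zero_slash]; exact zero_form_isBoundedAtImInfty, h0⟩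
  add_mem' {p r} hp hr := by
    have h0 : HasFourierExpansion (p.1 + r.1) (p.2 + r.2) := by
      obtain ⟨m, hm⟩ := hp.2.eventually_zero
      obtain ⟨n, hn⟩ := hr.2.eventually_zero
      refine ⟨⟨min m n, fun k hk ↦ ?_⟩, fun z ↦ ?_⟩
      · simp [hm k (by omega), hn k (by omega)]
      · simpa [add_mul] using (hp.2.hasSum z).add (hr.2.hasSum z)
    refine ⟨.of_slash (hp.1.holo.add hr.1.holo) (fun γ h ↦ ?_) h0 fun γ h ↦ ?_, h0⟩
    · simp only [Prod.fst_add, SlashAction.add_slash, hp.1.slash_eq γ h, hr.1.slash_eq γ h]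
    · rw [Prod.fst_add, SlashAction.add_slash]
      exact (hp.1.isBoundedAtImInfty_slash h).add (hr.1.isBoundedAtImInfty_slash h)
  smul_mem' c p hp := by
    have h0 : HasFourierExpansion (c • p.1) (c • p.2) := by
      obtain ⟨m, hm⟩ := hp.2.eventually_zero
      refine ⟨⟨m, fun k hk ↦ by simp [hm k hk]⟩, fun z ↦ ?_⟩
      simpa [mul_assoc] using (hp.2.hasSum z).mul_left c
    refine ⟨.of_slash (hp.1.holo.const_smul c) (fun γ h ↦ ?_) h0 fun γ h ↦ ?_, h0⟩
    · simp only [Prod.smul_fst, ModularForm.SL_smul_slash, hp.1.slash_eq γ h]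
    · rw [Prod.smul_fst, ModularForm.SL_smul_slash]
      exact (hp.1.isBoundedAtImInfty_slash h).const_smul_left c

lemma mem_expansions {N : ℕ} [NeZero N] {f : ℍ → ℂ} {a : ℤ → ℂ} :
    (f, a) ∈ expansions N ↔ IsMSharp 0 N f ∧ HasFourierExpansion f a := Iff.rfl

lemma eq_zero_of_mem_expansions {N : ℕ} [NeZero N] {f : ℍ → ℂ} {a : ℤ → ℂ}
    (h : (f, a) ∈ expansions N) (ha : ∀ n ≤ 0, a n = 0) : f = 0 := by
  obtain ⟨hf, hfa⟩ := mem_expansions.mp h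
  have hzero := hfa.isZeroAtImInfty ha
  let F : ModularForm ((Gamma0 N).map (mapGL ℝ)) 0 :=
    { toFun := f
      slash_action_eq' := by
        rintro _ ⟨γ, hγ, rfl⟩
        exact hf.slash_eq γ hγ
      holo' := hf.holo
      bdd_at_cusps' := by
        intro c hc
        rw [Subgroup.IsArithmetic.isCusp_iff_isCusp_SL2Z] at hc
        rw [OnePoint.isBoundedAt_iff_forall_SL2Z hc]
        intro γ _
        by_cases hγ : γ ∈ Gamma0 N
        · rw [show f ∣[(0 : ℤ)] γ = f from hf.slash_eq γ hγ]
          exact hzero.isBoundedAtImInfty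
        · exact hf.isBoundedAtImInfty_slash hγ }
  obtain ⟨c, hc⟩ := ModularForm.eq_const_of_weight_zero F
  replace hc : f = Function.const ℍ c := hc
  have : Tendsto (fun _ : ℍ ↦ c) atImInfty (𝓝 0) := by
    have h0 : Tendsto f atImInfty (𝓝 0) := hzero
    rwa [hc] at h0
  rw [hc, tendsto_nhds_unique tendsto_const_nhds this]
  rfl

lemma IsCanonical.unique {N m : ℕ} [NeZero N] {f g : ℍ → ℂ} (hf : IsCanonical N m f)
    (hg : IsCanonical N m g) : f = g := by
  obtain ⟨hf, a, hfa, ha1, ha0⟩ := hf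
  obtain ⟨hg, b, hgb, hb1, hb0⟩ := hg
  refine sub_eq_zero.mp <| eq_zero_of_mem_expansions (N := N) (a := a - b)
    (sub_mem (mem_expansions.mpr ⟨hf, hfa⟩) (mem_expansions.mpr ⟨hg, hgb⟩)) fun n hn ↦ ?_
  by_cases h : n = -(m : ℤ)
  · simp [h, ha1, hb1]
  · simp [ha0 n hn h, hb0 n hn h]

lemma exists_isCanonical {N : ℕ} [NeZero N]
    (h : ∀ m : ℕ, ∃ p ∈ expansions N, p.2 (-m) = 1 ∧ ∀ n < -(m : ℤ), p.2 n = 0) (m : ℕ) :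
    ∃ f, IsCanonical N m f := by
  suffices ∃ p ∈ expansions N, p.2 (-m) = 1 ∧ ∀ n : ℤ, n ≤ 0 → n ≠ -(m : ℤ) → p.2 n = 0 by
    obtain ⟨p, ⟨hp, hpa⟩, h1, h0⟩ := this
    exact ⟨p.1, hp, p.2, hpa, h1, h0⟩
  induction m using Nat.strong_induction_on with
  | _ m ih =>
    obtain ⟨p, hp, h1, h0⟩ := h m
    choose! P hP hP1 hP0 using ih
    -- Among nonpositive indices `P j` is supported at -j only, so each subtraction clears one
    -- coefficient and disturbs no other.
    refine ⟨p - ∑ j ∈ Finset.range m, p.2 (-j) • P j, sub_mem hp <| Submodule.sum_mem _ fun j hj ↦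
      Submodule.smul_mem _ _ (hP j (Finset.mem_range.mp hj)), ?_, fun n hn hnm ↦ ?_⟩
    · rw [Prod.snd_sub, Prod.snd_sum, Pi.sub_apply, h1, Finset.sum_apply, Finset.sum_eq_zero,
        sub_zero]
      intro j hj
      rw [Finset.mem_range] at hj
      simp [hP0 j hj (-m) (by omega) (by omega)]
    · obtain ⟨k, rfl⟩ : ∃ k : ℕ, n = -(k : ℤ) := ⟨n.natAbs, by omega⟩
      rw [Prod.snd_sub, Prod.snd_sum, Pi.sub_apply, Finset.sum_apply]
      by_cases hk : k < m
      · rw [Finset.sum_eq_single_of_mem k (Finset.mem_range.mpr hk)]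
        · simp [hP1 k hk]
        · intro j hj hjk
          simp [hP0 j (Finset.mem_range.mp hj) (-k) hn (by omega)]
      · rw [h0 _ (by omega), Finset.sum_eq_zero, sub_zero]
        intro j hj
        rw [Finset.mem_range] at hj
        simp [hP0 j hj (-k) hn (by omega)]

/-! ### Generators of Γ₀(2) and Γ₀(4) -/

/-- The matrix `(1, 0; n, 1)`. -/
def lowerUnipotent (n : ℤ) : SL(2, ℤ) := ⟨!![1, 0; n, 1], by simp⟩

lemma coe_lowerUnipotent (n : ℤ) :
    (lowerUnipotent n : Matrix (Fin 2) (Fin 2) ℤ) = !![1, 0; n, 1] := rfl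

lemma lowerUnipotent_add (m n : ℤ) :
    lowerUnipotent (m + n) = lowerUnipotent m * lowerUnipotent n := by
  ext i j
  fin_cases i <;> fin_cases j <;> simp [coe_lowerUnipotent]

lemma lowerUnipotent_zero : lowerUnipotent 0 = 1 := by
  ext i j
  fin_cases i <;> fin_cases j <;> simp [lowerUnipotent]

lemma lowerUnipotent_neg (n : ℤ) : lowerUnipotent (-n) = (lowerUnipotent n)⁻¹ :=
  eq_inv_of_mul_eq_one_left <| by rw [← lowerUnipotent_add, neg_add_cancel, lowerUnipotent_zero]

lemma coe_lowerUnipotent_smul (n : ℤ) (z : ℍ) :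
    ((lowerUnipotent n • z : ℍ) : ℂ) = z / (n * z + 1) := by
  rw [coe_specialLinearGroup_apply]
  simp [lowerUnipotent]

lemma exists_two_mul_abs_add_mul_le (x : ℤ) {m : ℤ} (hm : m ≠ 0) :
    ∃ k : ℤ, 2 * |x + m * k| ≤ |m| := by
  refine ⟨-round ((x : ℚ) / m), ?_⟩
  have h := abs_sub_round ((x : ℚ) / m)
  have hm' : (m : ℚ) ≠ 0 := mod_cast hm
  have : |(x + m * -round ((x : ℚ) / m) : ℚ)| = |(m : ℚ)| * |(x : ℚ) / m - round ((x : ℚ) / m)| := by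
    rw [← abs_mul]
    congr 1
    field_simp
    ring
  have h2 : 2 * |(x + m * -round ((x : ℚ) / m) : ℚ)| ≤ |(m : ℚ)| := by
    rw [this]
    nlinarith [abs_nonneg (m : ℚ)]
  exact_mod_cast h2

/-- For `N = 2` or `N = 4`, a function invariant under `z ↦ z + 1` and `z ↦ z / (N z + 1)` is invariant
under `Γ₀(N)`. -/
lemma smul_eq_of_mem_Gamma0 {N : ℕ} (hN : 2 ≤ N) (hN4 : N ≤ 4) (hN3 : N ≠ 3) {f : ℍ → ℂ}
    (hT : ∀ z, f ((1 : ℝ) +ᵥ z) = f z) (hV : ∀ z, f (lowerUnipotent N • z) = f z)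
    {γ : SL(2, ℤ)} (hγ : γ ∈ Gamma0 N) (z : ℍ) : f (γ • z) = f z := by
  let H : Subgroup SL(2, ℤ) :=
    { carrier := {γ | ∀ z, f (γ • z) = f z}
      one_mem' := fun z ↦ by rw [one_smul]
      mul_mem' := fun {a b} ha hb z ↦ by rw [mul_smul, ha, hb]
      inv_mem' := fun {a} ha z ↦ by rw [← ha, smul_inv_smul] }
  have hTH : ModularGroup.T ∈ H := fun z ↦ by rw [modular_T_smul, hT]
  have hVH (j : ℤ) : lowerUnipotent (N * j) ∈ H := by
    have hV1 : lowerUnipotent N ∈ H := hV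
    induction j using Int.induction_on with
    | zero => simp [lowerUnipotent_zero]
    | succ i hi => rw [mul_add, mul_one, lowerUnipotent_add]; exact mul_mem hi hV1
    | pred i hi =>
      rw [mul_sub, mul_one, sub_eq_add_neg, lowerUnipotent_add, lowerUnipotent_neg]
      exact mul_mem hi (inv_mem hV1)
  -- Euclidean descent on |c| for the bottom row (c, d): a power of T makes |d| ≤ |c|/2, then a
  -- lower unipotent makes the new |c| at most N|d|/2 ≤ N|c|/4.
  suffices ∀ n : ℕ, ∀ γ ∈ Gamma0 N, (γ 1 0).natAbs = n → γ ∈ H from this _ γ hγ rfl z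
  intro n
  induction n using Nat.strong_induction_on with
  | _ n ih =>
    intro γ hγ hn
    by_cases hc : γ 1 0 = 0
    · obtain ⟨k, hk⟩ := ModularGroup.exists_eq_T_zpow_of_c_eq_zero hc
      intro z
      rw [hk]
      exact zpow_mem hTH k z
    have hNc := mem_Gamma0_iff_dvd.mp hγ
    obtain ⟨k, hk⟩ := exists_two_mul_abs_add_mul_le (γ 1 1) hc
    set d := γ 1 1 + γ 1 0 * k with hd
    have hdet := Matrix.det_fin_two γ.1
    rw [γ.2] at hdet
    have hNd : ¬ 2 ∣ d ∨ N = 2 := by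
      by_contra! h
      obtain rfl : N = 4 := by omega
      have h2 : (2 : ℤ) ∣ γ 1 0 := dvd_trans (by norm_num) hNc
      have h3 : (2 : ℤ) ∣ γ 1 1 := by
        rw [show γ 1 1 = d - γ 1 0 * k by ring]
        exact dvd_sub h.1 (h2.mul_right k)
      have : (2 : ℤ) ∣ 1 := by
        rw [hdet]
        exact dvd_sub (h3.mul_left _) (h2.mul_left _)
      omega
    have hd0 : d ≠ 0 := by
      intro h0
      have h1 : γ 1 0 ∣ 1 :=
        ⟨-γ 0 0 * k - γ 0 1, by linear_combination hdet + γ 0 0 * (h0 - hd)⟩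
      have : (N : ℤ) ∣ 1 := hNc.trans h1
      have := Int.le_of_dvd one_pos this
      omega
    obtain ⟨j, hj⟩ := exists_two_mul_abs_add_mul_le (γ 1 0) (m := N * d)
      (mul_ne_zero (by omega) hd0)
    have hprod : (γ * ModularGroup.T ^ k * lowerUnipotent (N * j)) 1 0 = γ 1 0 + N * d * j := by
      simp [Matrix.mul_apply, Fin.sum_univ_two, coe_lowerUnipotent, ModularGroup.coe_T_zpow, hd]
      ring
    have hlt : |γ 1 0 + N * d * j| < |γ 1 0| := by
      rw [abs_mul, Nat.abs_cast] at hj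
      have hdpos : 0 < |d| := abs_pos.mpr hd0
      have hcpos : 0 < |γ 1 0| := abs_pos.mpr hc
      obtain rfl | rfl : N = 2 ∨ N = 4 := by omega
      · push_cast at *
        omega
      -- For N = 4 the descent estimate is strict only if 2|d| ≠ |c|; equality with 4 ∣ c would make
      -- d even, contradicting determinant 1.
      · have hne : 2 * |d| ≠ |γ 1 0| := by
          intro h
          have h4 : (4 : ℤ) ∣ |γ 1 0| := (dvd_abs _ _).mpr hNc
          have : (2 : ℤ) ∣ |d| := by omega
          rw [dvd_abs] at this
          omega
        push_cast at *
        omega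
    have hTk : ModularGroup.T ^ k ∈ H := zpow_mem hTH k
    have hmem := ih ((γ * ModularGroup.T ^ k * lowerUnipotent (N * j)) 1 0).natAbs
      (by rw [hprod, ← hn]; zify; exact hlt) (γ * ModularGroup.T ^ k * lowerUnipotent (N * j))
      (by rw [mem_Gamma0_iff_dvd, hprod]; exact dvd_add hNc ⟨d * j, by ring⟩) rfl
    rwa [H.mul_mem_cancel_right (hVH j), H.mul_mem_cancel_right hTk] at hmem

/-! ### Eta quotients and their behaviour at the cusps -/

/-- The Euler product `∏ (1 - x ^ (n + 1))`. -/
def eulerProd (x : ℂ) : ℂ := ∏' n : ℕ, (1 - x ^ (n + 1))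

lemma eta_eq_eulerProd (z : ℂ) :
    ModularForm.eta z = Periodic.qParam 24 z * eulerProd (Periodic.qParam 1 z) := rfl

lemma tendsto_eulerProd : Tendsto eulerProd (𝓝 0) (𝓝 1) := by
  have h := (ModularForm.differentiableOn_tprod_one_sub_pow.differentiableAt
    (Metric.ball_mem_nhds 0 one_pos)).continuousAt
  have h0 : eulerProd 0 = 1 := by simp [eulerProd]
  rw [← h0]
  exact h

/-- The eta quotient `(η(z) / η(N z)) ^ e`. -/
def etaQuotient (N e : ℕ) (z : ℍ) : ℂ :=
  (ModularForm.eta z / ModularForm.eta (N * z)) ^ e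

lemma natCast_mul_im_pos {N : ℕ} [NeZero N] (z : ℍ) : 0 < ((N : ℂ) * z).im := by
  have : (0 : ℝ) < N := mod_cast NeZero.pos N
  simpa using mul_pos this z.im_pos

lemma etaQuotient_ne_zero (N e : ℕ) [NeZero N] (z : ℍ) : etaQuotient N e z ≠ 0 :=
  pow_ne_zero _ (div_ne_zero (ModularForm.eta_ne_zero z.im_pos)
    (ModularForm.eta_ne_zero (natCast_mul_im_pos z)))

lemma mdifferentiable_etaQuotient (N e : ℕ) [NeZero N] : MDiff (etaQuotient N e) := by
  intro z
  have h1 := ModularForm.differentiableAt_eta_of_mem_upperHalfPlaneSet z.im_pos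
  have h2 := ModularForm.differentiableAt_eta_of_mem_upperHalfPlaneSet
    (natCast_mul_im_pos (N := N) z)
  have h3 : DifferentiableAt ℂ (fun w : ℂ ↦ ModularForm.eta (N * w)) z :=
    h2.comp (z : ℂ) (differentiableAt_id.const_mul (N : ℂ))
  have h4 := (h1.div h3 (ModularForm.eta_ne_zero (natCast_mul_im_pos z))).pow e
  exact h4.mdifferentiableAt.comp z (mdifferentiable_coe z)

/-- The condition says e(N - 1) = 24, so the fractional powers of q combine to exactly q⁻¹: e = 24
for N = 2 and e = 8 for N = 4. -/
lemma etaQuotient_eq {N e : ℕ} (he : e * N = e + 24) (z : ℍ) :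
    etaQuotient N e z = (q z)⁻¹ * (eulerProd (q z) / eulerProd (q z ^ N)) ^ e := by
  have h1 : Periodic.qParam 1 ((N : ℂ) * z) = q z ^ N := by
    simp only [q, Periodic.qParam, ← Complex.exp_nat_mul]
    congr 1
    ring
  have h2 : Periodic.qParam 24 (z : ℂ) ^ e / Periodic.qParam 24 ((N : ℂ) * z) ^ e = (q z)⁻¹ := by
    simp only [q, Periodic.qParam, ← Complex.exp_nat_mul, ← Complex.exp_neg, ← Complex.exp_sub]
    congr 1
    have : (e : ℂ) * N = e + 24 := mod_cast he
    push_cast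
    linear_combination (-(2 * Real.pi * Complex.I * z) / 24) * this
  rw [etaQuotient, eta_eq_eulerProd, eta_eq_eulerProd, h1, mul_div_mul_comm, mul_pow, div_pow, h2]

lemma etaQuotient_one_vadd {N e : ℕ} (he : e * N = e + 24) (z : ℍ) :
    etaQuotient N e ((1 : ℝ) +ᵥ z) = etaQuotient N e z := by
  simp only [etaQuotient_eq he, q_one_vadd]

lemma tendsto_q_mul_etaQuotient {N e : ℕ} [NeZero N] (he : e * N = e + 24) :
    Tendsto (fun z ↦ q z * etaQuotient N e z) atImInfty (𝓝 1) := by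
  have hq : Tendsto q atImInfty (𝓝 0) := qParam_tendsto_atImInfty one_pos
  have hqN : Tendsto (fun z ↦ q z ^ N) atImInfty (𝓝 0) := by
    simpa [NeZero.ne N] using hq.pow N
  have := ((tendsto_eulerProd.comp hq).div (tendsto_eulerProd.comp hqN) one_ne_zero).pow e
  rw [div_one, one_pow] at this
  refine this.congr fun z ↦ ?_
  rw [etaQuotient_eq he, mul_inv_cancel_left₀ (q_ne_zero z)]
  rfl

lemma tendsto_etaQuotient_inv {N e : ℕ} [NeZero N] (he : e * N = e + 24) :
    Tendsto (fun z ↦ (etaQuotient N e z)⁻¹) atImInfty (𝓝 0) := by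
  have hq : Tendsto q atImInfty (𝓝 0) := qParam_tendsto_atImInfty one_pos
  have := hq.mul ((tendsto_q_mul_etaQuotient (N := N) he).inv₀ one_ne_zero)
  rw [zero_mul] at this
  refine this.congr fun z ↦ ?_
  have := q_ne_zero z
  rw [mul_inv, mul_inv_cancel_left₀ this]

/-- The Fricke involution `z ↦ -1 / (N z)` inverts the eta quotient up to a constant. -/
lemma etaQuotient_mul_fricke {N k : ℕ} [NeZero N] {z w : ℍ} (h : (w : ℂ) * (N * z) = -1) :
    etaQuotient N (2 * k) w * etaQuotient N (2 * k) z = N ^ k := by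
  have hz := z.ne_zero
  have hN : (N : ℂ) ≠ 0 := NeZero.ne _
  have hNz := mul_ne_zero hN hz
  have hw : (w : ℂ) = -1 / (N * z) := by rw [eq_div_iff hNz, h]
  have hw' : (N : ℂ) * w = -1 / z := by rw [hw]; field_simp
  have e1 : ModularForm.eta w = (Complex.sqrt Complex.I)⁻¹ *
      (Complex.sqrt (N * z) * ModularForm.eta (N * z)) := by
    simpa [hw] using ModularForm.eta_comp_eq_csqrt_I_inv (natCast_mul_im_pos (N := N) z)
  have e2 : ModularForm.eta (N * w) = (Complex.sqrt Complex.I)⁻¹ *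
      (Complex.sqrt z * ModularForm.eta z) := by
    rw [hw']
    simpa using ModularForm.eta_comp_eq_csqrt_I_inv z.im_pos
  have s2 (x : ℂ) : Complex.sqrt x ^ 2 = x := by simp [Complex.sqrt]
  have s0 {x : ℂ} (hx : x ≠ 0) : Complex.sqrt x ≠ 0 := fun h0 ↦ hx <| by rw [← s2 x, h0]; simp
  have hI := s0 Complex.I_ne_zero
  have hsz := s0 hz
  have hη := ModularForm.eta_ne_zero z.im_pos
  have hηN := ModularForm.eta_ne_zero (natCast_mul_im_pos (N := N) z)
  rw [etaQuotient, etaQuotient, e1, e2, ← mul_pow]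
  have : (Complex.sqrt Complex.I)⁻¹ * (Complex.sqrt (N * z) * ModularForm.eta (N * z)) /
      ((Complex.sqrt Complex.I)⁻¹ * (Complex.sqrt z * ModularForm.eta z)) *
      (ModularForm.eta z / ModularForm.eta (N * z)) =
      Complex.sqrt (N * z) / Complex.sqrt z := by
    change ModularForm.eta (z : ℂ) ≠ 0 at hη
    field_simp
  -- The even exponent removes the square roots, so no choice of branch matters.
  rw [this, pow_mul, div_pow, s2, s2, mul_div_cancel_right₀ _ hz]

/-- The map z ↦ z/(Nz+1) is z ↦ z - 1 conjugated by the Fricke involution; the two inversions of the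
quotient cancel. -/
lemma etaQuotient_lowerUnipotent_smul {N k : ℕ} [NeZero N] (he : 2 * k * N = 2 * k + 24) (z : ℍ) :
    etaQuotient N (2 * k) (lowerUnipotent N • z) = etaQuotient N (2 * k) z := by
  have hz := z.ne_zero
  have hN : (N : ℂ) ≠ 0 := NeZero.ne _
  let y : ℍ := ⟨(N : ℂ) * z, natCast_mul_im_pos z⟩
  let w : ℍ := ⟨_, y.im_inv_neg_coe_pos⟩
  let w' : ℍ := (-1 : ℝ) +ᵥ w
  have hw : (w : ℂ) = (-((N : ℂ) * z))⁻¹ := rfl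
  have hw' : (w' : ℂ) = -1 + w := by simp [w']
  have hww : etaQuotient N (2 * k) w' = etaQuotient N (2 * k) w := by
    rw [← etaQuotient_one_vadd he w']
    simp [w', vadd_vadd]
  have hne : (N : ℂ) * z + 1 ≠ 0 := by
    intro h
    have h1 := congrArg Complex.im h
    have h2 := natCast_mul_im_pos (N := N) z
    simp only [Complex.add_im, Complex.one_im, add_zero, Complex.zero_im] at h1
    exact h2.ne' h1
  have h1 := etaQuotient_mul_fricke (N := N) (k := k) (z := w') (w := lowerUnipotent N • z) <| by
    rw [coe_lowerUnipotent_smul, hw', hw]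
    have h3 : (N : ℂ) * (-1 + (-((N : ℂ) * z))⁻¹) = -((N * z + 1) / z) := by
      field_simp
      ring
    rw [h3, Int.cast_natCast, mul_neg, div_mul_div_cancel₀ hne, div_self hz]
  have h2 := etaQuotient_mul_fricke (N := N) (k := k) (z := w) (w := z) <| by
    rw [hw]
    field_simp
  rw [hww] at h1
  exact mul_right_cancel₀ (etaQuotient_ne_zero N (2 * k) w) (h1.trans h2.symm)

lemma coe_S_smul_mul (z : ℍ) : ((ModularGroup.S • z : ℍ) : ℂ) * z = -1 := by
  have := z.ne_zero
  rw [modular_S_smul]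
  field_simp

/-- Such cusps are equivalent to 0: γ = δ S T^j with δ ∈ Γ₀(N). The Fricke relation turns the value
at Sx into N^k over the value at x/N, and the reciprocal of the quotient tends to 0 at i∞. -/
lemma isBoundedAtImInfty_etaQuotient_smul_of_isCoprime {N k : ℕ} [NeZero N]
    (he : 2 * k * N = 2 * k + 24)
    (hinv : ∀ γ ∈ Gamma0 N, ∀ z, etaQuotient N (2 * k) (γ • z) = etaQuotient N (2 * k) z)
    {γ : SL(2, ℤ)} (hγ : IsCoprime (γ 1 0) N) :
    IsBoundedAtImInfty fun z ↦ etaQuotient N (2 * k) (γ • z) := by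
  obtain ⟨u, v, huv⟩ := hγ
  -- With uc + vN = 1, multiplying by T^{-du} turns the bottom row (c, d) into (c, dvN); S⁻¹ moves
  -- the multiple of N to the lower left, up to sign.
  have hmem : γ * (ModularGroup.T ^ (γ 1 1 * u))⁻¹ * ModularGroup.S⁻¹ ∈ Gamma0 N := by
    rw [mem_Gamma0_iff_dvd]
    refine ⟨-(γ 1 1 * v), ?_⟩
    rw [← zpow_neg]
    simp [Matrix.mul_apply, Fin.sum_univ_two, ModularGroup.coe_T_zpow, ModularGroup.coe_S,
      Matrix.adjugate_fin_two]
    linear_combination γ 1 1 * huv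
  have hN : (N : ℂ) ≠ 0 := NeZero.ne _
  have hNpos : (0 : ℝ) < N := mod_cast NeZero.pos N
  obtain ⟨M, A, hA⟩ := isBoundedAtImInfty_iff.mp
    ((tendsto_etaQuotient_inv (N := N) he).isBigO_one ℝ)
  refine isBoundedAtImInfty_iff.mpr ⟨‖(N : ℂ) ^ k‖ * M, A * N, fun z hz ↦ ?_⟩
  let x : ℍ := ModularGroup.T ^ (γ 1 1 * u) • z
  have hx : x.im = z.im := by
    simp only [x, modular_T_zpow_smul, vadd_im]
  let y : ℍ := ⟨x / N, by simpa using div_pos x.im_pos hNpos⟩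
  have hy : A ≤ y.im := by
    have : y.im = x.im / N := by rw [← coe_im]; simp [y]
    rwa [this, hx, le_div_iff₀ hNpos]
  have h1 : etaQuotient N (2 * k) (γ • z) = etaQuotient N (2 * k) (ModularGroup.S • x) := by
    rw [← hinv _ hmem (ModularGroup.S • x)]
    simp [x, mul_smul]
  have h2 := etaQuotient_mul_fricke (N := N) (k := k) (z := y) (w := ModularGroup.S • x) <| by
    simp only [y, mul_div_cancel₀ _ hN]
    exact coe_S_smul_mul x
  rw [h1, eq_div_of_mul_eq (etaQuotient_ne_zero _ _ _) h2, div_eq_mul_inv, norm_mul]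
  exact mul_le_mul_of_nonneg_left (hA y hy) (norm_nonneg _)

lemma discriminant_smul (γ : SL(2, ℤ)) (z : ℍ) :
    ModularForm.discriminant (γ • z) =
      ((γ 1 0 : ℂ) * z + (γ 1 1 : ℂ)) ^ 12 * ModularForm.discriminant z := by
  have h := SlashInvariantForm.slash_action_generators_SL2Z
    ModularForm.discriminant_S_invariant ModularForm.discriminant_T_invariant γ
  exact (ModularForm.slash_action_eq'_iff 12 _ γ z).mp (congrFun h z)

lemma tendsto_vadd_atImInfty (x : ℝ) : Tendsto (fun z : ℍ ↦ x +ᵥ z) atImInfty atImInfty := by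
  rw [atImInfty, tendsto_comap_iff]
  exact tendsto_comap.congr fun z ↦ (vadd_im x z).symm

lemma tendsto_discriminant_div_half_vadd :
    Tendsto (fun z ↦ ModularForm.discriminant z / ModularForm.discriminant ((1 / 2 : ℝ) +ᵥ z))
      atImInfty (𝓝 (-1)) := by
  have h := ModularForm.tendsto_atImInfty_tprod_one_sub_eta_q_pow
  have := (h.div (h.comp (tendsto_vadd_atImInfty (1 / 2))) one_ne_zero).neg
  rw [div_one] at this
  refine this.congr fun z ↦ ?_
  have hq : q ((1 / 2 : ℝ) +ᵥ z) = -q z := by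
    simp only [q, Periodic.qParam, coe_vadd]
    rw [← mul_neg_one, ← Complex.exp_pi_mul_I, ← Complex.exp_add]
    congr 1
    push_cast
    ring
  rw [ModularForm.discriminant_eq_q_prod, ModularForm.discriminant_eq_q_prod]
  change _ = q z * _ / (q ((1 / 2 : ℝ) +ᵥ z) * _)
  rw [hq, mul_div_mul_comm, div_neg, div_self (q_ne_zero z), neg_one_mul]
  rfl

/-- The cusp 1/2 of Γ₀(4) escapes the Fricke argument. Cubing gives Δ(v)/Δ(4v), and with v =
z/(2z+1), y = z + 1/2 one has 4v = 2 - 1/y, so full SL₂(ℤ) modularity of Δ applies to both factors.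
-/
lemma etaQuotient_four_pow_three (z : ℍ) :
    etaQuotient 4 8 (lowerUnipotent 2 • z) ^ 3 =
      2 ^ 12 * (ModularForm.discriminant z / ModularForm.discriminant ((1 / 2 : ℝ) +ᵥ z)) := by
  have hne : (2 : ℂ) * z + 1 ≠ 0 := by
    intro h
    have h1 := congrArg Complex.im h
    have h2 := z.im_pos
    simp at h1
    exact h2.ne' h1
  set y : ℍ := (1 / 2 : ℝ) +ᵥ z with hy
  have hyc : (y : ℂ) = (2 * z + 1) / 2 := by
    simp only [hy, coe_vadd]
    push_cast
    ring
  have hD : ModularForm.discriminant y ≠ 0 := ModularForm.discriminant_ne_zero y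
  set v := lowerUnipotent 2 • z with hv
  have hvc : (v : ℂ) = z / (2 * z + 1) := by
    rw [hv, coe_lowerUnipotent_smul, Int.cast_ofNat]
  have h4 : (((2 : ℝ) +ᵥ (ModularGroup.S • y) : ℍ) : ℂ) = (4 : ℕ) * v := by
    rw [coe_vadd, eq_div_of_mul_eq y.ne_zero (coe_S_smul_mul y), hvc, hyc]
    push_cast
    field_simp
    ring
  have h5 : ModularForm.discriminant ((2 : ℝ) +ᵥ (ModularGroup.S • y)) =
      (y : ℂ) ^ 12 * ModularForm.discriminant y := by
    have h := modular_T_zpow_smul (ModularGroup.S • y) 2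
    rw [Int.cast_ofNat] at h
    rw [← h, discriminant_smul, discriminant_smul, ModularGroup.coe_T_zpow, ModularGroup.coe_S]
    simp
  have h6 : ModularForm.discriminant v = (2 * z + 1) ^ 12 * ModularForm.discriminant z := by
    rw [hv, discriminant_smul, coe_lowerUnipotent]
    simp
  have h7 : etaQuotient 4 8 v ^ 3 = ModularForm.discriminant v /
      ModularForm.discriminant ((2 : ℝ) +ᵥ (ModularGroup.S • y)) := by
    rw [etaQuotient, ← pow_mul, div_pow, ModularForm.discriminant, ModularForm.discriminant, h4]
  rw [h7, h6, h5, hyc]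
  field_simp

lemma isBoundedAtImInfty_etaQuotient_four_lowerUnipotent_two_smul :
    IsBoundedAtImInfty fun z ↦ etaQuotient 4 8 (lowerUnipotent 2 • z) := by
  have h := (tendsto_discriminant_div_half_vadd.const_mul (2 ^ 12)).isBigO_one ℝ
  obtain ⟨M, A, hA⟩ := isBoundedAtImInfty_iff.mp h
  refine isBoundedAtImInfty_iff.mpr ⟨max 1 M, A, fun z hz ↦ ?_⟩
  have h1 := hA z hz
  rw [← etaQuotient_four_pow_three, norm_pow] at h1
  rw [le_max_iff]
  by_contra! hcon
  -- A norm above max(1, M) would have a cube above M.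
  have := le_self_pow₀ hcon.1.le (n := 3) (by norm_num)
  linarith

lemma etaQuotient_smul {N k : ℕ} [NeZero N] (he : 2 * k * N = 2 * k + 24) (hN : 2 ≤ N)
    (hN4 : N ≤ 4) (hN3 : N ≠ 3) (γ : SL(2, ℤ)) (hγ : γ ∈ Gamma0 N) (z : ℍ) :
    etaQuotient N (2 * k) (γ • z) = etaQuotient N (2 * k) z :=
  smul_eq_of_mem_Gamma0 hN hN4 hN3 (etaQuotient_one_vadd he)
    (etaQuotient_lowerUnipotent_smul he) hγ z

lemma isCoprime_natCast_two_pow {x : ℤ} (hx : ¬ 2 ∣ x) (n : ℕ) :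
    IsCoprime x ((2 ^ n : ℕ) : ℤ) := by
  push_cast
  exact ((Int.prime_two.coprime_iff_not_dvd.mpr hx).symm).pow_right

lemma isBoundedAtImInfty_etaQuotient_two_smul {γ : SL(2, ℤ)} (hγ : γ ∉ Gamma0 2) :
    IsBoundedAtImInfty fun z ↦ etaQuotient 2 24 (γ • z) :=
  isBoundedAtImInfty_etaQuotient_smul_of_isCoprime (N := 2) (k := 12) (by norm_num)
    (etaQuotient_smul (by norm_num) (by norm_num) (by norm_num) (by norm_num))
    (isCoprime_natCast_two_pow (n := 1) (by rwa [mem_Gamma0_iff_dvd] at hγ))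

lemma isBoundedAtImInfty_etaQuotient_four_smul {γ : SL(2, ℤ)} (hγ : γ ∉ Gamma0 4) :
    IsBoundedAtImInfty fun z ↦ etaQuotient 4 8 (γ • z) := by
  have hinv := etaQuotient_smul (N := 4) (k := 4) (by norm_num) (by norm_num) (by norm_num)
    (by norm_num)
  -- Odd c is the cusp 0. If c ≡ 2 mod 4 then d is odd, so c - 2d is divisible by 4 and γ reduces to
  -- `lowerUnipotent 2`.
  by_cases h2 : 2 ∣ γ 1 0
  · rw [mem_Gamma0_iff_dvd] at hγ
    have hdet := Matrix.det_fin_two γ.1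
    rw [γ.2] at hdet
    have hd : ¬ 2 ∣ γ 1 1 := fun hd ↦ by
      have : (2 : ℤ) ∣ 1 := by
        rw [hdet]
        exact dvd_sub (hd.mul_left _) (h2.mul_left _)
      omega
    have hmem : γ * lowerUnipotent (-2) ∈ Gamma0 4 := by
      rw [mem_Gamma0_iff_dvd]
      have : (γ * lowerUnipotent (-2)) 1 0 = γ 1 0 - 2 * γ 1 1 := by
        simp [Matrix.mul_apply, Fin.sum_univ_two, coe_lowerUnipotent]
        ring
      rw [this]
      push_cast at *
      omega
    have (z : ℍ) : etaQuotient 4 8 (γ • z) = etaQuotient 4 8 (lowerUnipotent 2 • z) := by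
      rw [← hinv _ hmem (lowerUnipotent 2 • z), lowerUnipotent_neg, mul_smul, inv_smul_smul]
    simpa only [this] using isBoundedAtImInfty_etaQuotient_four_lowerUnipotent_two_smul
  · exact isBoundedAtImInfty_etaQuotient_smul_of_isCoprime (N := 4) (k := 4) (by norm_num) hinv
      (isCoprime_natCast_two_pow (n := 2) h2)

lemma exists_isCanonical_of_etaQuotient {N k : ℕ} [NeZero N] (he : 2 * k * N = 2 * k + 24)
    (hinv : ∀ γ ∈ Gamma0 N, ∀ z, etaQuotient N (2 * k) (γ • z) = etaQuotient N (2 * k) z)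
    (hbdd : ∀ γ ∉ Gamma0 N, IsBoundedAtImInfty fun z ↦ etaQuotient N (2 * k) (γ • z)) (m : ℕ) :
    ∃ f, IsCanonical N m f := by
  refine exists_isCanonical (fun m ↦ ?_) m
  have hlim := (tendsto_q_mul_etaQuotient (N := N) he).pow m
  simp only [mul_pow, one_pow] at hlim
  have hdiff := (mdifferentiable_etaQuotient N (2 * k)).pow m
  obtain ⟨a, ha, ha1, ha0⟩ := exists_hasFourierExpansion (f := etaQuotient N (2 * k) ^ m) hdiff
    (fun z ↦ by simp only [Pi.pow_apply, etaQuotient_one_vadd he]) hlim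
  refine ⟨(_, a), mem_expansions.mpr ⟨.of_slash hdiff (fun γ hγ ↦ ?_) ha fun γ hγ ↦ ?_, ha⟩,
    ha1, ha0⟩
  · ext z
    rw [slash_zero_apply, Pi.pow_apply, hinv γ hγ, Pi.pow_apply]
  · have hslash : (etaQuotient N (2 * k) ^ m) ∣[(0 : ℤ)] γ =
        fun z ↦ etaQuotient N (2 * k) (γ • z) ^ m := by
      ext z
      rw [slash_zero_apply, Pi.pow_apply]
    rw [hslash]
    obtain ⟨M, A, hA⟩ := isBoundedAtImInfty_iff.mp (hbdd γ hγ)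
    refine isBoundedAtImInfty_iff.mpr ⟨M ^ m, A, fun z hz ↦ ?_⟩
    rw [norm_pow]
    exact pow_le_pow_left₀ (norm_nonneg _) (hA z hz) m

lemma exists_isCanonical_two (m : ℕ) : ∃ f, IsCanonical 2 m f :=
  exists_isCanonical_of_etaQuotient (k := 12) (by norm_num)
    (etaQuotient_smul (by norm_num) (by norm_num) (by norm_num) (by norm_num))
    (fun _ ↦ isBoundedAtImInfty_etaQuotient_two_smul) m

lemma exists_isCanonical_four (m : ℕ) : ∃ f, IsCanonical 4 m f :=
  exists_isCanonical_of_etaQuotient (k := 4) (by norm_num)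
    (etaQuotient_smul (by norm_num) (by norm_num) (by norm_num) (by norm_num))
    (fun _ ↦ isBoundedAtImInfty_etaQuotient_four_smul) m

/-! ### The operator U_2 from level 4 to level 2 -/

/-- The matrix `(1, j; 0, 2)`, acting by `z ↦ (z + j) / 2`. -/
def halfShift (j : ℤ) : GL (Fin 2) ℝ :=
  Matrix.GeneralLinearGroup.mkOfDetNeZero !![1, (j : ℝ); 0, 2] (by simp)

lemma coe_halfShift (j : ℤ) :
    (halfShift j : Matrix (Fin 2) (Fin 2) ℝ) = !![1, (j : ℝ); 0, 2] := rfl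

lemma det_halfShift (j : ℤ) : (halfShift j).det.val = 2 := by
  rw [Matrix.GeneralLinearGroup.val_det_apply, coe_halfShift]
  simp

lemma coe_halfShift_smul (j : ℤ) (z : ℍ) : ((halfShift j • z : ℍ) : ℂ) = (z + j) / 2 := by
  rw [coe_smul_of_det_pos (by rw [det_halfShift]; norm_num)]
  simp [num, denom, coe_halfShift]

/-- The factor 1/2 is det^(k-1) at k = 0, precisely the normalization U_2 needs. -/
lemma slash_halfShift_apply (f : ℍ → ℂ) (j : ℤ) (z : ℍ) :
    (f ∣[(0 : ℤ)] halfShift j) z = 2⁻¹ * f (halfShift j • z) := by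
  rw [ModularForm.slash_apply, det_halfShift, σ, if_pos (by rw [det_halfShift]; norm_num)]
  simp [mul_comm]

lemma q_halfShift_zero_smul_sq (z : ℍ) : q (halfShift 0 • z) ^ 2 = q z := by
  simp only [q, Periodic.qParam, coe_halfShift_smul, ← Complex.exp_nat_mul]
  congr 1
  push_cast
  ring

lemma q_halfShift_one_smul (z : ℍ) : q (halfShift 1 • z) = -q (halfShift 0 • z) := by
  simp only [q, Periodic.qParam, coe_halfShift_smul]
  rw [← mul_neg_one, ← Complex.exp_pi_mul_I, ← Complex.exp_add]
  congr 1
  push_cast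
  ring

/-- The two points have nomes ±q^{1/2}; averaging cancels the odd powers and keeps the even ones. -/
lemma HasFourierExpansion.hasSum_slash_halfShift {f : ℍ → ℂ} {a : ℤ → ℂ}
    (hf : HasFourierExpansion f a) (z : ℍ) :
    HasSum (fun n : ℤ ↦ a (2 * n) * q z ^ n)
      ((f ∣[(0 : ℤ)] halfShift 0 + f ∣[(0 : ℤ)] halfShift 1) z) := by
  have h := ((hf.hasSum (halfShift 0 • z)).mul_left 2⁻¹).add
    ((hf.hasSum (halfShift 1 • z)).mul_left 2⁻¹)
  have hinj : Injective fun n : ℤ ↦ 2 * n := mul_right_injective₀ two_ne_zero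
  rw [Pi.add_apply, slash_halfShift_apply, slash_halfShift_apply]
  rw [← hinj.hasSum_iff] at h
  · convert! h using 2 with n
    simp only [comp_apply, q_halfShift_one_smul, (even_two_mul n).neg_zpow]
    rw [zpow_mul, zpow_ofNat, q_halfShift_zero_smul_sq]
    ring
  · intro n hn
    have hodd : Odd n := by
      rw [← Int.not_even_iff_odd]
      rintro ⟨k, rfl⟩
      exact hn ⟨k, by simp only; ring⟩
    rw [q_halfShift_one_smul, hodd.neg_zpow]
    ring

lemma HasFourierExpansion.U_two_eq {f : ℍ → ℂ} {a : ℤ → ℂ} (hf : HasFourierExpansion f a) :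
    U 2 f = f ∣[(0 : ℤ)] halfShift 0 + f ∣[(0 : ℤ)] halfShift 1 := by
  ext z
  simp only [U, hf.qCoeff_eq]
  exact (hf.hasSum_slash_halfShift z).tsum_eq

lemma HasFourierExpansion.U_two {f : ℍ → ℂ} {a : ℤ → ℂ} (hf : HasFourierExpansion f a) :
    HasFourierExpansion (U 2 f) fun n ↦ a (2 * n) := by
  obtain ⟨m, hm⟩ := hf.eventually_zero
  exact ⟨⟨-|m|, fun n hn ↦ hm _ (by have := neg_abs_le m; have := abs_nonneg m; omega)⟩,
    fun z ↦ hf.U_two_eq ▸ hf.hasSum_slash_halfShift z⟩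

/-- Write `halfShift i` · γ = δ · `halfShift j`. The congruence makes δ integral, and its lower left
entry 2c is divisible by 4 because c is even, so δ ∈ Γ₀(4) is absorbed by f. -/
lemma IsMSharp.slash_halfShift_slash {f : ℍ → ℂ} (hf : IsMSharp 0 4 f) {γ : SL(2, ℤ)}
    (hγ : γ ∈ Gamma0 2) {i j : ℤ} (hij : 2 ∣ γ 0 1 + i * γ 1 1 - j * (γ 0 0 + i * γ 1 0)) :
    (f ∣[(0 : ℤ)] halfShift i) ∣[(0 : ℤ)] γ = f ∣[(0 : ℤ)] halfShift j := by
  obtain ⟨b, hb⟩ := hij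
  have hdet := Matrix.det_fin_two γ.1
  rw [γ.2] at hdet
  obtain ⟨δ, hδc⟩ : ∃ δ : SL(2, ℤ), (δ : Matrix (Fin 2) (Fin 2) ℤ) =
      !![γ 0 0 + i * γ 1 0, b; 2 * γ 1 0, γ 1 1 - j * γ 1 0] := ⟨⟨_, by
    rw [Matrix.det_fin_two_of]
    linear_combination γ 1 0 * hb - hdet⟩, rfl⟩
  have hδ : δ ∈ Gamma0 4 := by
    obtain ⟨c, hc⟩ := mem_Gamma0_iff_dvd.mp hγ
    refine mem_Gamma0_iff_dvd.mpr ⟨c, ?_⟩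
    simp only [hδc, Matrix.of_apply, Matrix.cons_val, hc]
    push_cast
    ring
  have hb' : (γ 0 1 : ℝ) + i * γ 1 1 - j * (γ 0 0 + i * γ 1 0) = 2 * b := mod_cast hb
  have hmul : halfShift i * mapGL ℝ γ = mapGL ℝ δ * halfShift j := by
    ext r s
    fin_cases r <;> fin_cases s <;>
      simp [coe_halfShift, Matrix.mul_apply, Fin.sum_univ_two, hδc] <;>
      first | ring1 | linear_combination hb'
  rw [ModularForm.SL_slash, ← SlashAction.slash_mul]
  change f ∣[(0 : ℤ)] (halfShift i * mapGL ℝ γ) = _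
  rw [hmul, SlashAction.slash_mul]
  congr 1
  exact hf.slash_eq δ hδ

/-- The relevant cusp is (a + jc)/(2c) with c odd. If it were δ∞ with δ ∈ Γ₀(4), cross-multiplying
would force the upper left entry of δ to be even, impossible beside a lower left entry divisible by
4. -/
lemma IsMSharp.isBoundedAtImInfty_slash_halfShift_slash {f : ℍ → ℂ} (hf : IsMSharp 0 4 f)
    {γ : SL(2, ℤ)} (hγ : γ ∉ Gamma0 2) (j : ℤ) :
    IsBoundedAtImInfty ((f ∣[(0 : ℤ)] halfShift j) ∣[(0 : ℤ)] γ) := by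
  rw [mem_Gamma0_iff_dvd] at hγ
  rw [ModularForm.SL_slash, ← SlashAction.slash_mul]
  set g : GL (Fin 2) ℝ := halfShift j * mapGL ℝ γ with hg
  have hg0 : g 0 0 = ((γ 0 0 + j * γ 1 0 : ℤ) : ℝ) := by
    simp [hg, coe_halfShift, Matrix.mul_apply, Fin.sum_univ_two]
  have hg1 : g 1 0 = ((2 * γ 1 0 : ℤ) : ℝ) := by
    simp [hg, coe_halfShift, Matrix.mul_apply, Fin.sum_univ_two]
  have hne : γ 1 0 ≠ 0 := fun h ↦ hγ (h ▸ dvd_zero _)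
  have hgne : g 1 0 ≠ 0 := by
    rw [hg1]
    exact_mod_cast mul_ne_zero two_ne_zero hne
  refine hf.bdd_at_other_cusps (g • ∞) ?_ (fun δ hδ h ↦ ?_) g rfl
  · rw [Subgroup.IsArithmetic.isCusp_iff_isCusp_SL2Z, isCusp_SL2Z_iff]
    refine ⟨(((γ 0 0 + j * γ 1 0 : ℤ) : ℚ) / ((2 * γ 1 0 : ℤ) : ℚ) : ℚ), ?_⟩
    rw [OnePoint.smul_infty_eq_ite, if_neg hgne, hg0, hg1, OnePoint.map_some]
    push_cast
    rfl
  · obtain ⟨s, hs⟩ := mem_Gamma0_iff_dvd.mp hδ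
    rw [OnePoint.smul_infty_eq_ite g, if_neg hgne, OnePoint.smul_infty_eq_ite] at h
    split_ifs at h with h0
    · exact OnePoint.infty_ne_coe _ h
    rw [OnePoint.coe_eq_coe, div_eq_div_iff h0 hgne, hg0, hg1] at h
    have h' : δ 0 0 * (2 * γ 1 0) = (γ 0 0 + j * γ 1 0) * δ 1 0 := by
      have : ((δ 0 0 * (2 * γ 1 0) : ℤ) : ℝ) = (((γ 0 0 + j * γ 1 0) * δ 1 0 : ℤ) : ℝ) := by
        simpa using h
      exact_mod_cast this
    have hdet := Matrix.det_fin_two δ.1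
    rw [δ.2] at hdet
    push_cast at hs hγ
    have h2 : (2 : ℤ) ∣ δ 0 0 * γ 1 0 :=
      ⟨(γ 0 0 + j * γ 1 0) * s, by rw [hs] at h'; linarith⟩
    obtain ⟨u, hu⟩ := (Int.prime_two.dvd_or_dvd h2).resolve_right hγ
    have : (2 : ℤ) ∣ 1 := ⟨u * δ 1 1 - δ 0 1 * (2 * s), by
      linear_combination hdet + δ 1 1 * hu - δ 0 1 * hs⟩
    omega

lemma IsMSharp.U_two {f : ℍ → ℂ} (hf : IsMSharp 0 4 f) : IsMSharp 0 2 (U 2 f) := by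
  obtain ⟨a, ha⟩ := hf.meromorphic_infty
  refine .of_slash ?_ (fun γ hγ ↦ ?_) ha.U_two fun γ hγ ↦ ?_ <;> rw [ha.U_two_eq]
  · exact (hf.holo.slash 0 _).add (hf.holo.slash 0 _)
  · have hdet := Matrix.det_fin_two γ.1
    rw [γ.2] at hdet
    have hc : (2 : ℤ) ∣ γ 1 0 := mem_Gamma0_iff_dvd.mp hγ
    have hodd : Odd (γ 0 0 * γ 1 1) := by
      rw [show γ 0 0 * γ 1 1 = 1 + γ 0 1 * γ 1 0 by linarith]
      exact odd_one.add_even ((even_iff_two_dvd.mpr hc).mul_left _)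
    obtain ⟨ha1, hd1⟩ := Int.odd_mul.mp hodd
    rw [Int.odd_iff] at ha1 hd1
    rw [SlashAction.add_slash]
    -- The diagonal of γ is odd and c even, so γ acts on the shifts mod 2 by j ↦ j + b: it fixes or
    -- swaps the two summands.
    by_cases hb : (2 : ℤ) ∣ γ 0 1
    · rw [hf.slash_halfShift_slash hγ (i := 0) (j := 0) (by omega),
        hf.slash_halfShift_slash hγ (i := 1) (j := 1) (by omega)]
    · rw [hf.slash_halfShift_slash hγ (i := 0) (j := 1) (by omega),
        hf.slash_halfShift_slash hγ (i := 1) (j := 0) (by omega), add_comm]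
  · rw [SlashAction.add_slash]
    exact (hf.isBoundedAtImInfty_slash_halfShift_slash hγ 0).add
      (hf.isBoundedAtImInfty_slash_halfShift_slash hγ 1)

lemma IsCanonical.U_two_even {m : ℕ} {f : ℍ → ℂ} (hf : IsCanonical 4 (2 * m) f) :
    IsCanonical 2 m (U 2 f) := by
  obtain ⟨hf, a, ha, h1, h0⟩ := hf
  refine ⟨hf.U_two, _, ha.U_two, ?_, fun n hn hnm ↦ h0 _ (by omega) (by push_cast; omega)⟩
  simpa using h1

lemma IsCanonical.U_two_odd {m : ℕ} {f : ℍ → ℂ} (hf : IsCanonical 4 (2 * m + 1) f) :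
    U 2 f = 0 := by
  obtain ⟨hf, a, ha, -, h0⟩ := hf
  exact eq_zero_of_mem_expansions (N := 2) (mem_expansions.mpr ⟨hf.U_two, ha.U_two⟩)
    fun n hn ↦ h0 _ (by omega) (by push_cast; omega)

end WeaklyHolomorphic

end

open WeaklyHolomorphic in
theorem theorem4 (m : ℕ) :
    (∃! f : ℍ → ℂ, IsCanonical 4 m f) ∧
    (∃! g : ℍ → ℂ, IsCanonical 2 m g) ∧
    (∀ f g : ℍ → ℂ, IsCanonical 4 (2 * m) f → IsCanonical 2 m g → U 2 f = g) ∧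
    (∀ f : ℍ → ℂ, IsCanonical 4 (2 * m + 1) f → U 2 f = 0) := by
  refine ⟨?_, ?_, fun f g hf hg ↦ hf.U_two_even.unique hg, fun f hf ↦ hf.U_two_odd⟩
  · obtain ⟨f, hf⟩ := exists_isCanonical_four m
    exact ⟨f, hf, fun g hg ↦ hg.unique hf⟩
  · obtain ⟨f, hf⟩ := exists_isCanonical_two m
    exact ⟨f, hf, fun g hg ↦ hg.unique hf⟩
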